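/- \textbf{Theorem.} Let $\mathbb F_q$ be a finite field and let $a\neq b$ be positive integers. Put $w(X)=\frac{b}{\gcd(a,b)}$, $w(Y)=\frac{a}{\gcd(a,b)}$ and $w(X^{i}Y^{j})=i\,w(X)+j\,w(Y)$. Let $F(X,Y)=X^a+\alpha Y^b+R(X,Y)\in\mathbb F_q[X,Y]$ with $\alpha\neq 0$, where all monomials in the support of $R$ have weight smaller than $w(X^a)=w(Y^b)=\frac{ab}{\gcd(a,b)}$ (a generalised $C_{ab}$ polynomial), and assume that $F$ is optimal, i.e. that it has exactly $aq$ zeros in $\mathbb F_q^2$. Let $I_q=\langle F,\;X^q-X,\;Y^q-Y\rangle$, let $V\subseteq\mathbb F_q^2$ be its set of zeros over $\mathbb F_q$, and let $\mathrm{ev}:\mathbb F_q[X,Y]/I_q\to\mathbb F_q^{V}$ be the evaluation map $A+I_q\mapsto (A(P))_{P\in V}$. Let $\prec_w$ be the weighted degree lexicographic ordering: monomials are compared by their weight $w$, and ties are broken lexicographically with $Y\prec_{lex}X$. Let $M_1\prec_w\cdots\prec_w M_n$ be the elements of the footprint $\Delta_{\prec_w}(I_q)$, i.e. of the set of monomials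 that are not the leading monomial of any nonzero polynomial in $I_q$ (this footprint is in fact the box $\{X^{i_1}Y^{i_2}\mid 0\le i_1<a,\ 0\le i_2<q\}$). Let $\vec c=\mathrm{ev}\big(\sum_{s=1}^{i}a_sM_s+I_q\big)$ with $a_1,\dots,a_i\in\mathbb F_q$ and $a_i\neq 0$, and write $M_i=X^{\alpha_1}Y^{\alpha_2}$ and $T=\alpha_1 \bmod w(Y)$ (the remainder in $\{0,\dots,w(Y)-1\}$). Then the Hamming weight of $\vec c$ satisfies $$w_H(\vec c)\;\ge\;(a-\alpha_1)(q-\alpha_2)+\epsilon ,$$ where $$\epsilon=\begin{cases} 0 & \text{if } q-b\le\alpha_2<q,\\ T(q-\alpha_2-b) & \text{if } 0\le\alpha_1\le a-w(Y)\text{ and }0\le\alpha_2<q-b,\\ \alpha_1(q-\alpha_2-b) & \text{if } a-w(Y)<\alpha_1<a\text{ and } q-w(X)-\alpha_1\frac{b-w(X)}{a-w(Y)}<\alpha_2<q-b,\\ T(q-\alpha_2-w(X)) & \text{if } a-w(Y)<\alpha_1<a\text{ and } 0\le\alpha_2\le q-w(X)-\alpha_1\frac{b-w(X)}{a-w(Y)}.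 \end{cases}$$ If $\gcd(a,b)=1$, the fraction $\frac{b-w(X)}{a-w(Y)}=\frac00$ is read as $0$; in this situation the last two expressions for $\epsilon$ coincide. -/

import Mathlib

open scoped MonomialOrder

noncomputable section

namespace GenCab

/-! ### Weighted degree lexicographic orderings -/

/-- A copy of the type of exponent vectors, to be ordered by the weights `w` and then
lexicographically. -/
@[nolint unusedArguments]
def WDegLex {σ : Type*} (_w : σ → ℕ) : Type _ := σ →₀ ℕ

namespace WDegLex

variable {σ : Type*} (w : σ → ℕ)

instance : AddCommMonoid (WDegLex w) := inferInstanceAs (AddCommMonoid (σ →₀ ℕ))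

/-- The key according to which exponent vectors are compared: first the weight, then the
exponent vector itself, lexicographically. -/
def key (d : σ →₀ ℕ) : ℕ ×ₗ Lex (σ →₀ ℕ) := toLex (Finsupp.weight w d, toLex d)

theorem key_injective : Function.Injective (key w) := fun a b h => by
  have h' : (Finsupp.weight w a, toLex a) = (Finsupp.weight w b, toLex b) := toLex.injective h
  exact toLex.injective (Prod.ext_iff.mp h').2

instance [LinearOrder σ] : LinearOrder (WDegLex w) :=
  LinearOrder.lift' (fun d : WDegLex w => key w d) (key_injective w)

theorem le_iff_key [LinearOrder σ] (x y : WDegLex w) : x ≤ y ↔ key w x ≤ key w y := Iff.rfl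

theorem key_le_iff [LinearOrder σ] (x y : σ →₀ ℕ) : key w x ≤ key w y ↔
    Finsupp.weight w x < Finsupp.weight w y ∨
      (Finsupp.weight w x = Finsupp.weight w y ∧ toLex x ≤ toLex y) :=
  Prod.Lex.toLex_le_toLex

theorem key_mono [LinearOrder σ] {x y : σ →₀ ℕ} (h : x ≤ y) : key w x ≤ key w y := by
  rw [key_le_iff]
  have hw : Finsupp.weight w x ≤ Finsupp.weight w y := by
    rw [← add_tsub_cancel_of_le h, map_add]
    exact Nat.le_add_right _ _
  rcases hw.lt_or_eq with h1 | h1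
  · exact Or.inl h1
  · exact Or.inr ⟨h1, Finsupp.toLex_monotone h⟩

theorem key_add_le [LinearOrder σ] {x y : σ →₀ ℕ} (h : key w x ≤ key w y) (z : σ →₀ ℕ) :
    key w (x + z) ≤ key w (y + z) := by
  rw [key_le_iff] at h ⊢
  rcases h with h | ⟨h1, h2⟩
  · left
    rw [map_add, map_add]
    exact Nat.add_lt_add_right h _
  · right
    refine ⟨by rw [map_add, map_add, h1], ?_⟩
    rw [toLex_add, toLex_add]
    exact add_le_add_left h2 _

instance [LinearOrder σ] : IsOrderedAddMonoid (WDegLex w) where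
  add_le_add_left a b h c := key_add_le w (x := a) (y := b) h c

instance [LinearOrder σ] [WellFoundedGT σ] : WellFoundedLT (WDegLex w) :=
  ⟨InvImage.wf (fun d : WDegLex w => key w d) wellFounded_lt⟩

end WDegLex

/-- The weighted degree lexicographic ordering with weights `w`: monomials are compared by their
weight `∑ j, d j * w j`, ties being broken lexicographically; the variable of the smallest index
is the largest one in the lexicographic ordering. -/
def wDegLex {σ : Type*} [LinearOrder σ] [WellFoundedGT σ] (w : σ → ℕ) : MonomialOrder σ where
  syn := WDegLex w
  toSyn := { toEquiv := Equiv.refl (σ →₀ ℕ), map_add' := fun _ _ => rfl }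
  toSyn_monotone _ _ h := WDegLex.key_mono w h

theorem wDegLex_lt_iff {σ : Type*} [LinearOrder σ] [WellFoundedGT σ] (w : σ → ℕ)
    (x y : σ →₀ ℕ) : x ≺[wDegLex w] y ↔
      Finsupp.weight w x < Finsupp.weight w y ∨
        (Finsupp.weight w x = Finsupp.weight w y ∧ toLex x < toLex y) := by
  change WDegLex.key w x < WDegLex.key w y ↔ _
  exact Prod.Lex.toLex_lt_toLex

/-! ### Footprints and affine variety codes -/

/-- The footprint of the ideal `J`: the (exponent vectors of) monomials that are not the leading
monomial of any nonzero polynomial in `J`. -/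
def footprint {σ k : Type*} [Field k] (m : MonomialOrder σ) (J : Ideal (MvPolynomial σ k)) :
    Set (σ →₀ ℕ) :=
  {d | ∀ f ∈ J, f ≠ 0 → m.degree f ≠ d}

variable {σ K : Type*} [Field K]

/-- `I_q = I + ⟨X_j ^ q - X_j : j⟩`. -/
def idealQ [Fintype K] (I : Ideal (MvPolynomial σ K)) : Ideal (MvPolynomial σ K) :=
  I ⊔ Ideal.span
    (Set.range fun j : σ => (MvPolynomial.X j ^ Fintype.card K - MvPolynomial.X j))

/-- The points, with coordinates in `K`, of the variety of the ideal `J`. -/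
abbrev Points (J : Ideal (MvPolynomial σ K)) : Type _ := ↥(MvPolynomial.zeroLocus K J)

instance [Finite σ] [Finite K] (J : Ideal (MvPolynomial σ K)) : Fintype (Points J) :=
  Fintype.ofFinite _

/-- The evaluation map `A + J ↦ (A(P))_P`, where `P` runs through the points of the variety. -/
def ev (J : Ideal (MvPolynomial σ K)) : (MvPolynomial σ K ⧸ J) →+* (Points J → K) :=
  Ideal.Quotient.lift J (RingHom.pi fun P : Points J => MvPolynomial.eval P.1) (by
    intro f hf
    funext P
    exact P.2 f hf)

/-! ### Generalised `C_ab` polynomials; the variables are `X = X 0` and `Y = X 1` -/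

/-- The weights `w(X) = b / gcd(a,b)` and `w(Y) = a / gcd(a,b)` (both divisions are exact). -/
def wt (a b : ℕ) : Fin 2 → ℕ := ![b / Nat.gcd a b, a / Nat.gcd a b]

/-- `F = X^a + α Y^b + R` is a generalised `C_ab` polynomial. -/
def IsGenCab (a b : ℕ) (F : MvPolynomial (Fin 2) K) : Prop :=
  0 < a ∧ 0 < b ∧ a ≠ b ∧
    ∃ (α : K) (R : MvPolynomial (Fin 2) K), α ≠ 0 ∧
      F = MvPolynomial.X 0 ^ a + MvPolynomial.C α * MvPolynomial.X 1 ^ b + R ∧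
      ∀ d ∈ R.support, Finsupp.weight (wt a b) d < a * b / Nat.gcd a b

/-- A generalised `C_ab` polynomial over the finite field `K` is optimal if it has exactly
`a * #K` zeros in `K × K`. -/
def IsOptimalGenCab [Fintype K] (a b : ℕ) (F : MvPolynomial (Fin 2) K) : Prop :=
  IsGenCab a b F ∧
    {P : Fin 2 → K | MvPolynomial.eval P F = 0}.ncard = a * Fintype.card K

open Classical in
/-- The improvement term `ε`, as a function of `a`, `b`, `q` and of an exponent pair `α₁ < a`,
`α₂ < q`. The four branches, in this order, are the following.
* `q - b ≤ α₂`;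
* `α₁ ≤ a - w(Y)` and `α₂ < q - b`;
* `a - w(Y) < α₁` and `q - w(X) - α₁ (b - w(X)) / (a - w(Y)) < α₂ < q - b`;
* `a - w(Y) < α₁` and `α₂ ≤ q - w(X) - α₁ (b - w(X)) / (a - w(Y))`.

If `gcd(a,b) = 1` then `b - w(X) = a - w(Y) = 0`, and the last two branches give the same value
(`T = α₁` and `w(X) = b`), so that the value of the quotient does not matter. -/
def epsilon (a b q α₁ α₂ : ℕ) : ℚ :=
  let wX : ℚ := (wt a b 0 : ℕ)
  let wY : ℚ := (wt a b 1 : ℕ)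
  let T : ℚ := (α₁ % wt a b 1 : ℕ)
  if (q : ℚ) - b ≤ α₂ then 0
  else if (α₁ : ℚ) ≤ a - wY then T * (q - α₂ - b)
  else if (q : ℚ) - wX - α₁ * ((b - wX) / (a - wY)) < α₂ then α₁ * (q - α₂ - b)
  else T * (q - α₂ - wX)

end GenCab

end

namespace GenCab

/-! ### Triangular families -/

/-! Multiplication by a function `f` on the point set `V` is a diagonal matrix of rank equal to the
Hamming weight of `f`. Hence multiples of `f` with distinct leading monomials in the box, being
independent, bound the weight from below (`card_le_hammingNorm`). Leading monomials make sense
because the box monomials are independent on `V`: the curve relation and `y ^ q = y` reduce every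
monomial to the box, so the box spans all functions, and optimality makes its size `a * q` equal to
the number of points (`linearIndepOn_box`).

Multipliers that keep the top monomial inside the box give `(a - α₁)(q - α₂)`. The gain `ε` comes
from multipliers pushing the `X`-exponent past `a`, where `X ^ a` is traded for `-α Y ^ b` of the
same weight but smaller in the ordering. Either all terms of top weight wrap around together
(`isLead_mod`), or the top monomial wraps and the next term of that weight, if any, takes the lead
(`exists_isLead`). The second gain depends on an unknown `t` between `1` and `gcd a b`; it is
concave in `t`, so the worst case is an endpoint, and for `α₁ > a - w(Y)` the term `ε` is the
smaller endpoint value (`le_of_two_bounds`, `add_epsilon_le`). -/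

theorem linearIndepOn_of_triangular {K E ι κ : Type*} [Field K] [AddCommGroup E] [Module K E]
    [LinearOrder κ] {key : ι → κ} (hkey : Function.Injective key) {e h : ι → E} {B : Set ι}
    (he : LinearIndepOn K e B) (D : Finset ι) (hD : ∀ d ∈ D, d ∈ B)
    (hh : ∀ d ∈ D, ∃ c : K, c ≠ 0 ∧
      h d - c • e d ∈ Submodule.span K (e '' {p | p ∈ B ∧ key p < key d})) :
    LinearIndepOn K h (D : Set ι) := by
  classical
  induction D using Finset.induction_on_max_value key with
  | empty => simp
  | insert d D hdD hmax ih =>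
    rw [Finset.coe_insert]
    refine (ih (fun p hp => hD p (Finset.mem_insert_of_mem hp))
      (fun p hp => hh p (Finset.mem_insert_of_mem hp))).insert fun hmem => ?_
    obtain ⟨c, hc, hcd⟩ := hh d (Finset.mem_insert_self d D)
    have hsub : Submodule.span K (h '' (D : Set ι)) ≤
        Submodule.span K (e '' {p | p ∈ B ∧ key p < key d}) := by
      rw [Submodule.span_le]
      rintro _ ⟨p, hp, rfl⟩
      have hpd : key p < key d :=
        lt_of_le_of_ne (hmax p hp) fun heq => hdD (hkey heq ▸ hp)
      obtain ⟨c', -, hc'⟩ := hh p (Finset.mem_insert_of_mem hp)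
      have h1 : e p ∈ Submodule.span K (e '' {p | p ∈ B ∧ key p < key d}) :=
        Submodule.subset_span ⟨p, ⟨hD p (Finset.mem_insert_of_mem hp), hpd⟩, rfl⟩
      have h2 := Submodule.span_mono (R := K) (Set.image_mono (f := e)
        (show {z | z ∈ B ∧ key z < key p} ⊆ {z | z ∈ B ∧ key z < key d} from
          fun z hz => ⟨hz.1, hz.2.trans hpd⟩)) hc'
      simpa using add_mem h2 (Submodule.smul_mem _ c' h1)
    -- If `h d` depended on the earlier `h p`, solving for its leading term would put `e d` in the
    -- span of smaller `e p`.
    have h3 : e d ∈ Submodule.span K (e '' {p | p ∈ B ∧ key p < key d}) := by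
      have := Submodule.smul_mem _ c⁻¹ (sub_mem (hsub hmem) hcd)
      simpa [smul_smul, hc] using this
    refine (he.mono (fun p hp => hp.1)).notMem_span_iff.mpr
      ⟨he.mono ?_, fun hd => lt_irrefl _ hd.2⟩ h3
    rintro p (rfl | hp)
    exacts [hD p (Finset.mem_insert_self p D), hp.1]

/-! ### Monomials in two functions and their weighted ordering -/

/-- The weight of `X ^ p.1 * Y ^ p.2` when `X` and `Y` have weights `u` and `v`. -/
def wdeg (u v : ℕ) (p : ℕ × ℕ) : ℕ := p.1 * u + p.2 * v

/-- Exponent pairs are compared by weight, then by the exponent of `X`. -/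
def lkey (u v : ℕ) (p : ℕ × ℕ) : ℕ ×ₗ ℕ := toLex (wdeg u v p, p.1)

theorem lkey_lt_iff {u v : ℕ} {p d : ℕ × ℕ} :
    lkey u v p < lkey u v d ↔ wdeg u v p < wdeg u v d ∨ wdeg u v p = wdeg u v d ∧ p.1 < d.1 :=
  Prod.Lex.toLex_lt_toLex

theorem lkey_injective {u v : ℕ} (hv : 0 < v) : Function.Injective (lkey u v) := by
  rintro ⟨p₁, p₂⟩ ⟨d₁, d₂⟩ h
  have h' := Prod.ext_iff.mp (toLex.injective h)
  simp only [wdeg] at h'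
  obtain ⟨h1, rfl⟩ := h'
  have := Nat.eq_of_mul_eq_mul_right hv (Nat.add_left_cancel h1)
  rw [this]

theorem wdeg_add (u v : ℕ) (p s : ℕ × ℕ) : wdeg u v (p + s) = wdeg u v p + wdeg u v s := by
  simp only [wdeg, Prod.fst_add, Prod.snd_add]; ring

theorem lkey_add_lt {u v : ℕ} {p d : ℕ × ℕ} (h : lkey u v p < lkey u v d) (s : ℕ × ℕ) :
    lkey u v (p + s) < lkey u v (d + s) := by
  rw [lkey_lt_iff] at h ⊢
  rw [wdeg_add, wdeg_add, Prod.fst_add, Prod.fst_add]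
  omega

/-- Equal weight means `(d.1 - p.1) * u = (p.2 - d.2) * v`, so coprimality forces `v` to divide the
first difference: monomials of equal weight differ by multiples of `(v, -u)`. -/
theorem exists_shift_of_wdeg_eq {u v : ℕ} (hv : 0 < v) (huv : Nat.Coprime u v) {p d : ℕ × ℕ}
    (hw : wdeg u v p = wdeg u v d) (h : p.1 ≤ d.1) :
    ∃ t, d.1 = p.1 + t * v ∧ p.2 = d.2 + t * u := by
  obtain ⟨s, hs⟩ := Nat.exists_eq_add_of_le h
  simp only [wdeg] at hw
  rw [hs] at hw
  have h1 : p.2 * v = s * u + d.2 * v := by nlinarith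
  have h2 : v ∣ s * u := (Nat.dvd_add_left (Dvd.intro_left d.2 rfl)).mp (h1 ▸ Dvd.intro_left p.2 rfl)
  obtain ⟨t, rfl⟩ := huv.symm.dvd_of_dvd_mul_right h2
  refine ⟨t, by rw [hs, mul_comm], Nat.eq_of_mul_eq_mul_right hv ?_⟩
  rw [h1]; ring

section

variable {K V : Type*} [Field K]

/-- The function `x ^ p.1 * y ^ p.2`. -/
def mon (x y : V → K) (p : ℕ × ℕ) : V → K := x ^ p.1 * y ^ p.2

theorem mon_add (x y : V → K) (p s : ℕ × ℕ) : mon x y (p + s) = mon x y p * mon x y s := by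
  simp only [mon, Prod.fst_add, Prod.snd_add, pow_add]; ring

/-- The exponent pairs of the monomials `X ^ i * Y ^ j` with `i < a` and `j < q`. -/
def box (a q : ℕ) : Set (ℕ × ℕ) := {p | p.1 < a ∧ p.2 < q}

/-- The span of the monomials of the box that are smaller than `d`. -/
def lower (a q u v : ℕ) (x y : V → K) (d : ℕ × ℕ) : Submodule K (V → K) :=
  Submodule.span K (mon x y '' {p | p ∈ box a q ∧ lkey u v p < lkey u v d})

/-- The functions `x` and `y` satisfy `y ^ q = y` and an equation `x ^ a + α y ^ b + ⋯ = 0` whose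
first two terms have the same weight and whose other terms have smaller weight. -/
structure CurveRel (a b q u v : ℕ) (α : K) (x y : V → K) : Prop where
  v_pos : 0 < v
  one_lt : 1 < q
  coprime : Nat.Coprime u v
  weight_eq : a * u = b * v
  a_pos : 0 < a
  alpha_ne : α ≠ 0
  pow_card : y ^ q = y
  rel : x ^ a + α • y ^ b ∈ Submodule.span K (mon x y '' {p | wdeg u v p < a * u})

/-! ### Reduction of monomials to the box -/

namespace CurveRel

variable {a b q u v : ℕ} {α : K} {x y : V → K} (H : CurveRel a b q u v α x y)
include H

theorem reduce_mem_span (i j : ℕ) : mon x y (i + a, j) + α • mon x y (i, j + b) ∈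
    Submodule.span K (mon x y '' {p | wdeg u v p < wdeg u v (i + a, j)}) := by
  have key : mon x y (i + a, j) + α • mon x y (i, j + b)
      = LinearMap.mulLeft K (mon x y (i, j)) (x ^ a + α • y ^ b) := by
    simp only [mon, LinearMap.mulLeft_apply, mul_add, mul_smul_comm, pow_add]
    congr 1
    · ring
    · rw [mul_assoc]
  rw [key]
  have h1 := Submodule.mem_map_of_mem (f := LinearMap.mulLeft K (mon x y (i, j))) H.rel
  rw [Submodule.map_span] at h1
  refine Submodule.span_mono ?_ h1
  rintro _ ⟨_, ⟨p, hp, rfl⟩, rfl⟩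
  refine ⟨(i, j) + p, ?_, by rw [mon_add]; rfl⟩
  rw [Set.mem_ofPred_eq] at hp ⊢
  rw [wdeg_add]
  simp only [wdeg] at hp ⊢
  nlinarith

/-- Both rewriting rules lower the key, so reduction terminates and never rises above the monomial
it starts from. -/
theorem mon_mem_span (p : ℕ × ℕ) : mon x y p ∈
    Submodule.span K (mon x y '' {z | z ∈ box a q ∧ lkey u v z ≤ lkey u v p}) := by
  have hwf : WellFounded fun p d : ℕ × ℕ => lkey u v p < lkey u v d :=
    InvImage.wf (lkey u v) wellFounded_lt
  induction p using hwf.induction with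
  | _ p ih =>
    have ih' : ∀ z, lkey u v z < lkey u v p → mon x y z ∈
        Submodule.span K (mon x y '' {z | z ∈ box a q ∧ lkey u v z ≤ lkey u v p}) :=
      fun z hz => Submodule.span_mono (Set.image_mono
        (Set.ofPred_subset_ofPred.mpr fun t ht => ⟨ht.1, ht.2.trans hz.le⟩)) (ih z hz)
    obtain ⟨p₁, p₂⟩ := p
    by_cases h1 : a ≤ p₁
    · obtain ⟨i, rfl⟩ := Nat.exists_eq_add_of_le' h1
      -- Trading `X ^ a` for `Y ^ b` preserves the weight, and the tie is broken by the smaller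
      -- `X`-exponent.
      have h2 : mon x y (i, p₂ + b) ∈ _ := ih' (i, p₂ + b) (by
        rw [lkey_lt_iff]
        right
        have := H.weight_eq
        have := H.a_pos
        simp only [wdeg]
        constructor
        · nlinarith
        · omega)
      have h3 : mon x y (i + a, p₂) + α • mon x y (i, p₂ + b) ∈ Submodule.span K
          (mon x y '' {z | z ∈ box a q ∧ lkey u v z ≤ lkey u v (i + a, p₂)}) := by
        refine Submodule.span_le.mpr ?_ (H.reduce_mem_span i p₂)
        rintro _ ⟨z, hz, rfl⟩
        exact ih' z (lkey_lt_iff.mpr (Or.inl hz))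
      simpa using sub_mem h3 (Submodule.smul_mem _ α h2)
    · by_cases h2 : q ≤ p₂
      · obtain ⟨j, rfl⟩ := Nat.exists_eq_add_of_le' h2
        have h3 : mon x y (p₁, j + q) = mon x y (p₁, j + 1) := by
          simp only [mon, pow_add, H.pow_card, pow_one]
        rw [h3]
        refine ih' _ (lkey_lt_iff.mpr (Or.inl ?_))
        have := Nat.mul_lt_mul_of_pos_right H.one_lt H.v_pos
        simp only [wdeg]
        nlinarith
      · exact Submodule.subset_span ⟨_, ⟨⟨by simpa using h1, by simpa using h2⟩, le_rfl⟩, rfl⟩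

theorem mon_mem_lower {p d : ℕ × ℕ} (h : lkey u v p < lkey u v d) :
    mon x y p ∈ lower a q u v x y d :=
  Submodule.span_mono (Set.image_mono
    (Set.ofPred_subset_ofPred.mpr fun _ hz => ⟨hz.1, hz.2.trans_lt h⟩)) (H.mon_mem_span p)

theorem reduce_mem_lower {i j : ℕ} {d : ℕ × ℕ} (h : wdeg u v (i + a, j) ≤ wdeg u v d) :
    mon x y (i + a, j) + α • mon x y (i, j + b) ∈ lower a q u v x y d := by
  refine Submodule.span_le.mpr ?_ (H.reduce_mem_span i j)
  rintro _ ⟨z, hz, rfl⟩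
  exact H.mon_mem_lower (lkey_lt_iff.mpr (Or.inl (lt_of_lt_of_le hz h)))

theorem linearIndepOn_box [Fintype V] (hcard : Fintype.card V = a * q)
    (hspan : ⊤ ≤ Submodule.span K (Set.range (mon x y))) :
    LinearIndepOn K (mon x y) (box a q) := by
  have hle : Submodule.span K (Set.range (mon x y)) ≤
      Submodule.span K (Set.range fun p : Fin a × Fin q => mon x y (p.1, p.2)) := by
    rw [Submodule.span_le]
    rintro _ ⟨p, rfl⟩
    refine Submodule.span_mono ?_ (H.mon_mem_span p)
    rintro _ ⟨z, ⟨hz, -⟩, rfl⟩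
    exact ⟨(⟨z.1, hz.1⟩, ⟨z.2, hz.2⟩), rfl⟩
  have hli := linearIndependent_of_top_le_span_of_card_eq_finrank (hspan.trans hle) (by
    simp [hcard])
  have := hli.comp (fun p : box a q => ((⟨p.1.1, p.2.1⟩, ⟨p.1.2, p.2.2⟩) : Fin a × Fin q)) (by
    rintro ⟨⟨p₁, p₂⟩, hp⟩ ⟨⟨d₁, d₂⟩, hd⟩ h
    simpa using h)
  exact this

end CurveRel

end

end GenCab

namespace GenCab

/-! ### Leading monomials of multiples and the Hamming weight -/

section

variable {K V : Type*} [Field K]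

/-- The monomial with exponents `d` is the leading monomial of some multiple of `f`. -/
def IsLead (a q u v : ℕ) (x y f : V → K) (d : ℕ × ℕ) : Prop :=
  ∃ g : V → K, ∃ c : K, c ≠ 0 ∧ g * f - c • mon x y d ∈ lower a q u v x y d

theorem card_le_hammingNorm [Fintype V] [DecidableEq K] {a q u v : ℕ} {x y f : V → K}
    (hv : 0 < v) (he : LinearIndepOn K (mon x y) (box a q)) (D : Finset (ℕ × ℕ))
    (hD : ∀ d ∈ D, d ∈ box a q) (hlead : ∀ d ∈ D, IsLead a q u v x y f d) :
    D.card ≤ hammingNorm f := by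
  classical
  choose! g hg using hlead
  have h1 := linearIndepOn_of_triangular (lkey_injective (u := u) hv) he D hD hg
  have hmem : ∀ d : D, g d * f ∈ LinearMap.range (Matrix.diagonal f).mulVecLin := by
    intro d
    refine ⟨g d, ?_⟩
    ext P
    simp [Matrix.mulVec_diagonal, mul_comm]
  have h2 : LinearIndependent K
      (fun d : D => (⟨g d * f, hmem d⟩ : LinearMap.range (Matrix.diagonal f).mulVecLin)) :=
    LinearIndependent.of_comp (LinearMap.range (Matrix.diagonal f).mulVecLin).subtype h1
  have h3 := h2.fintype_card_le_finrank
  rw [Fintype.card_coe] at h3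
  refine h3.trans (le_of_eq ?_)
  rw [← Matrix.rank.eq_1, Matrix.rank_diagonal, hammingNorm, Fintype.card_subtype]

/-- The rectangles are disjoint because they lie on opposite sides of the column `α₁`. Truncated
subtraction lets the second one be empty. -/
theorem rectangles_le_hammingNorm [Fintype V] [DecidableEq K] {a q u v α₁ α₂ x₀ y₀ : ℕ}
    {x y f : V → K} (hv : 0 < v) (he : LinearIndepOn K (mon x y) (box a q))
    (h₁ : α₁ ≤ a) (h : ∀ i j, α₁ ≤ i → i < a → α₂ ≤ j → j < q → IsLead a q u v x y f (i, j))
    (h' : ∀ i j, x₀ ≤ i → i < α₁ → y₀ ≤ j → j < q → IsLead a q u v x y f (i, j)) :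
    (a - α₁) * (q - α₂) + (α₁ - x₀) * (q - y₀) ≤ hammingNorm f := by
  classical
  have := card_le_hammingNorm (f := f) hv he
    (Finset.Ico α₁ a ×ˢ Finset.Ico α₂ q ∪ Finset.Ico x₀ α₁ ×ˢ Finset.Ico y₀ q)
    (by
      rintro ⟨i, j⟩ hd
      simp only [Finset.mem_union, Finset.mem_product, Finset.mem_Ico] at hd
      simp only [box, Set.mem_ofPred_eq]
      omega)
    (by
      rintro ⟨i, j⟩ hd
      simp only [Finset.mem_union, Finset.mem_product, Finset.mem_Ico] at hd
      rcases hd with ⟨⟨h1, h2⟩, h3, h4⟩ | ⟨⟨h1, h2⟩, h3, h4⟩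
      · exact h i j h1 h2 h3 h4
      · exact h' i j h1 h2 h3 h4)
  rwa [Finset.card_union_of_disjoint, Finset.card_product, Finset.card_product, Nat.card_Ico,
    Nat.card_Ico, Nat.card_Ico, Nat.card_Ico] at this
  rw [Finset.disjoint_left]
  rintro ⟨i, j⟩ h1 h2
  simp only [Finset.mem_product, Finset.mem_Ico] at h1 h2
  omega

/-- The multiplier is a single monomial, and `p₀` is the only term of `f` contributing at `d`. The
constant `c` may differ from `C p₀`, since the shifted `p₀` may itself have to be reduced to reach
`d`. -/
theorem isLead_of_shift {a q u v : ℕ} {x y : V → K} (S : Finset (ℕ × ℕ)) (C : ℕ × ℕ → K)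
    (s d p₀ : ℕ × ℕ) (hp₀ : p₀ ∈ S) {c : K} (hc : c ≠ 0)
    (hd : C p₀ • mon x y (p₀ + s) - c • mon x y d ∈ lower a q u v x y d)
    (hS : ∀ p ∈ S, p ≠ p₀ → mon x y (p + s) ∈ lower a q u v x y d) :
    IsLead a q u v x y (∑ p ∈ S, C p • mon x y p) d := by
  classical
  refine ⟨mon x y s, c, hc, ?_⟩
  have h1 : mon x y s * ∑ p ∈ S, C p • mon x y p
      = C p₀ • mon x y (p₀ + s) + ∑ p ∈ S.erase p₀, C p • mon x y (p + s) := by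
    rw [Finset.add_sum_erase S (fun p => C p • mon x y (p + s)) hp₀, Finset.mul_sum]
    refine Finset.sum_congr rfl fun p _ => ?_
    rw [mul_smul_comm, mon_add, mul_comm]
  rw [h1, add_sub_right_comm]
  refine add_mem hd (sum_mem fun p hp => Submodule.smul_mem _ _ ?_)
  exact hS p (Finset.mem_of_mem_erase hp) (Finset.ne_of_mem_erase hp)

/-! ### Rectangles of leading monomials -/

namespace CurveRel

variable {a b q u v : ℕ} {α : K} {x y : V → K} (H : CurveRel a b q u v α x y)
  {S : Finset (ℕ × ℕ)} {C : ℕ × ℕ → K} {α₁ α₂ : ℕ}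
include H

theorem mon_reduce_mem_lower {i j : ℕ} {d : ℕ × ℕ} (h : wdeg u v (i + a, j) ≤ wdeg u v d)
    (hi : i < d.1) : mon x y (i + a, j) ∈ lower a q u v x y d := by
  have h1 : mon x y (i, j + b) ∈ lower a q u v x y d := H.mon_mem_lower (by
    rw [lkey_lt_iff]
    have := H.weight_eq
    have h2 : wdeg u v (i + a, j) = wdeg u v (i, j + b) := by simp only [wdeg]; nlinarith
    omega)
  simpa using sub_mem (H.reduce_mem_lower h) (Submodule.smul_mem _ α h1)

theorem smul_reduce_mem_lower {i j : ℕ} {d : ℕ × ℕ} (c : K) (hd : d = (i, j + b)) :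
    c • mon x y (i + a, j) - (-(c * α)) • mon x y d ∈ lower a q u v x y d := by
  subst hd
  have h := H.reduce_mem_lower (i := i) (j := j) (d := (i, j + b)) (le_of_eq (by
    have := H.weight_eq
    simp only [wdeg]; nlinarith))
  have := Submodule.smul_mem _ c h
  rwa [smul_add, smul_smul, ← sub_neg_eq_add, ← neg_smul] at this

variable (hA : (α₁, α₂) ∈ S) (hC : ∀ p ∈ S, C p ≠ 0)
  (hS : ∀ p ∈ S, p ≠ (α₁, α₂) → lkey u v p < lkey u v (α₁, α₂))
include hA hC hS

theorem isLead_mul {i j : ℕ} (hi : α₁ ≤ i) (hj : α₂ ≤ j) :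
    IsLead a q u v x y (∑ p ∈ S, C p • mon x y p) (i, j) := by
  obtain ⟨i, rfl⟩ := Nat.exists_eq_add_of_le hi
  obtain ⟨j, rfl⟩ := Nat.exists_eq_add_of_le hj
  refine isLead_of_shift S C (i, j) _ _ hA (hC _ hA) ?_ fun p hp hne => ?_
  · rw [Prod.mk_add_mk, sub_self]
    exact zero_mem _
  · exact H.mon_mem_lower (lkey_add_lt (hS p hp hne) (i, j))

/-- With `T = α₁ % v`, the multiplier `X ^ (a - T + i)` makes every term of top weight cross the
line `a`, so their order survives the wraparound. -/
theorem isLead_mod (h₁ : α₁ < a) {i j : ℕ} (hi : α₁ - α₁ % v ≤ i) (hi' : i < α₁)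
    (hj : α₂ + b ≤ j) : IsLead a q u v x y (∑ p ∈ S, C p • mon x y p) (i, j) := by
  have hv := H.v_pos
  have hTle := Nat.mod_le α₁ v
  obtain ⟨i, rfl⟩ := Nat.exists_eq_add_of_le hi
  obtain ⟨j, rfl⟩ := Nat.exists_eq_add_of_le hj
  have hw := H.weight_eq
  have hα := H.alpha_ne
  refine isLead_of_shift S C (a - α₁ % v + i, j) _ _ hA (c := -(C (α₁, α₂) * α))
    (by simp [hC _ hA, hα]) ?_ fun p hp hne => ?_
  · have h1 : ((α₁, α₂) + (a - α₁ % v + i, j) : ℕ × ℕ)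
        = (α₁ - α₁ % v + i + a, α₂ + j) := by
      ext <;> simp; omega
    rw [h1]
    exact H.smul_reduce_mem_lower _ (by ext <;> simp; omega)
  · have hdw : wdeg u v (α₁ - α₁ % v + i, α₂ + b + j)
        = wdeg u v (α₁, α₂) + wdeg u v (a - α₁ % v + i, j) := by
      obtain ⟨m, hm⟩ := Nat.exists_eq_add_of_le (show α₁ % v ≤ a by omega)
      obtain ⟨l, hl⟩ := Nat.exists_eq_add_of_le hTle
      have e1 : α₁ - α₁ % v = l := by omega
      have e2 : a - α₁ % v = m := by omega
      have e3 : (l + α₁ % v) * u + (m * u) = l * u + b * v := by rw [← hw, hm]; ring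
      simp only [wdeg, e1, e2]
      rw [show α₁ * u = (l + α₁ % v) * u by rw [add_comm l, ← hl]]
      linarith
    rcases lkey_lt_iff.mp (hS p hp hne) with h | ⟨h, hlt⟩
    · refine H.mon_mem_lower (lkey_lt_iff.mpr (Or.inl ?_))
      rw [wdeg_add, hdw]
      omega
    · obtain ⟨p₁, p₂⟩ := p
      obtain ⟨t, ht, ht'⟩ := exists_shift_of_wdeg_eq hv H.coprime h hlt.le
      simp only at ht ht' hlt
      -- A term of top weight has `X`-exponent congruent to `α₁` modulo `v`, hence at least `T`, so
      -- it wraps as well.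
      have hT : α₁ % v ≤ p₁ := by
        rw [ht, Nat.add_mul_mod_self_right]
        exact Nat.mod_le _ _
      have h1 : ((p₁, p₂) + (a - α₁ % v + i, j) : ℕ × ℕ)
          = (p₁ - α₁ % v + i + a, p₂ + j) := by
        ext <;> simp; omega
      have h2 := wdeg_add u v (p₁, p₂) (a - α₁ % v + i, j)
      rw [h1] at h2 ⊢
      exact H.mon_reduce_mem_lower (by omega) (by simp only; omega)

/-- The multiplier `X ^ (a - α₁ + i)` wraps the top monomial. The new leader is either its reduction
or the next term of the same weight, lying `t` steps `(-v, u)` away. -/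
theorem exists_isLead (h₁ : α₁ < a) {k : ℕ} (hva : a = k * v) (hub : b = k * u) : ∃ t, 1 ≤ t ∧ t ≤ k ∧ ∀ i j, a - t * v ≤ i → i < α₁ → α₂ + t * u ≤ j →
      IsLead a q u v x y (∑ p ∈ S, C p • mon x y p) (i, j) := by
  classical
  have hv := H.v_pos
  have hw := H.weight_eq
  have hα := H.alpha_ne
  have hk : 1 ≤ k := by
    rcases Nat.eq_zero_or_pos k with rfl | hk
    · omega
    · exact hk
  rcases (S.filter fun p => p ≠ (α₁, α₂) ∧ wdeg u v p = wdeg u v (α₁, α₂)).eq_empty_or_nonempty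
    with hE | hE
  -- No competitor of equal weight: the wrapped monomial still leads. For `t = k` one has `a - t * v
  -- = 0` and `t * u = b`.
  · refine ⟨k, hk, le_rfl, fun i j _ hi hj => ?_⟩
    rw [← hub] at hj
    obtain ⟨j, rfl⟩ := Nat.exists_eq_add_of_le hj
    refine isLead_of_shift S C (a - α₁ + i, j) _ _ hA (c := -(C (α₁, α₂) * α))
      (by simp [hC _ hA, hα]) ?_ fun p hp hne => ?_
    · have h1 : ((α₁, α₂) + (a - α₁ + i, j) : ℕ × ℕ) = (i + a, α₂ + j) := by
        ext <;> simp; omega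
      rw [h1]
      exact H.smul_reduce_mem_lower _ (by ext <;> simp; omega)
    · rcases lkey_lt_iff.mp (hS p hp hne) with h | ⟨h, -⟩
      · refine H.mon_mem_lower (lkey_lt_iff.mpr (Or.inl ?_))
        rw [wdeg_add]
        have h2 : wdeg u v (i, α₂ + b + j) = wdeg u v ((α₁, α₂) + (a - α₁ + i, j)) := by
          simp only [Prod.mk_add_mk, wdeg, show α₁ + (a - α₁ + i) = a + i by omega]
          nlinarith
        rw [h2, wdeg_add]
        omega
      · exact absurd (Finset.mem_filter.mpr ⟨hp, hne, h⟩) (hE ▸ Finset.notMem_empty p)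
  · obtain ⟨p, hp, hmax⟩ := Finset.exists_max_image _ (fun p : ℕ × ℕ => p.1) hE
    obtain ⟨hpS, hpne, hpw⟩ := Finset.mem_filter.mp hp
    have hlt : p.1 < α₁ := by
      have := lkey_lt_iff.mp (hS p hpS hpne)
      simp only at this
      omega
    obtain ⟨p₁, p₂⟩ := p
    obtain ⟨t, ht, ht'⟩ := exists_shift_of_wdeg_eq hv H.coprime hpw hlt.le
    simp only at ht ht' hlt hmax
    have hta : t * v < k * v := by omega
    have htk : t < k := Nat.lt_of_mul_lt_mul_right hta
    have ht1 : 1 ≤ t := by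
      rcases Nat.eq_zero_or_pos t with rfl | h
      · omega
      · exact h
    refine ⟨t, ht1, htk.le, fun i j hi hi' hj => ?_⟩
    obtain ⟨j, rfl⟩ := Nat.exists_eq_add_of_le hj
    obtain ⟨i, rfl⟩ := Nat.exists_eq_add_of_le hi
    have hd : ((p₁, p₂) + (a - α₁ + i, j) : ℕ × ℕ) = (a - t * v + i, α₂ + t * u + j) := by
      ext <;> simp <;> omega
    have hdw : wdeg u v (a - t * v + i, α₂ + t * u + j)
        = wdeg u v (α₁, α₂) + wdeg u v (a - α₁ + i, j) := by
      rw [← hd, wdeg_add, hpw]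
    refine isLead_of_shift S C (a - α₁ + i, j) _ _ hpS (hC _ hpS) ?_ fun z hz hne => ?_
    · rw [hd, sub_self]
      exact zero_mem _
    -- The former top monomial wraps, ending at a smaller `X`-exponent than the shifted competitor;
    -- all other terms were already below that competitor.
    · by_cases hzA : z = (α₁, α₂)
      · subst hzA
        have h1 : ((α₁, α₂) + (a - α₁ + i, j) : ℕ × ℕ) = (i + a, α₂ + j) := by
          ext <;> simp; omega
        have h2 := wdeg_add u v (α₁, α₂) (a - α₁ + i, j)
        rw [h1] at h2 ⊢
        exact H.mon_reduce_mem_lower (by omega) (by simp only; omega)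
      · refine H.mon_mem_lower ?_
        rw [← hd]
        refine lkey_add_lt ?_ _
        rcases lkey_lt_iff.mp (hS z hz hzA) with h | ⟨h, -⟩
        · rw [lkey_lt_iff, hpw]
          exact Or.inl h
        · refine lt_of_le_of_ne ?_ fun h' => hne (lkey_injective hv h')
          have h3 := hmax z (Finset.mem_filter.mpr ⟨hz, hzA, h⟩)
          rw [← not_lt, lkey_lt_iff, hpw, h]
          simp only
          omega

end CurveRel

end

end GenCab

namespace GenCab

/-! ### The improvement term -/

/-- The product is quadratic in `t` with leading coefficient `-u * v ≤ 0`, so on `[1, k]` it is at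
least the chord through its endpoint values. -/
theorem le_of_two_bounds {T v u Q k t E : ℚ} (hu : 0 ≤ u) (hv : 0 ≤ v) (h1 : 1 ≤ t) (hk : t ≤ k)
    (hE₁ : E ≤ T * (Q - u)) (hE₂ : E ≤ (T + (k - 1) * v) * (Q - k * u)) :
    E ≤ (T + (t - 1) * v) * (Q - t * u) := by
  rcases (h1.trans hk).eq_or_lt with rfl | hk1
  · obtain rfl : t = 1 := le_antisymm hk h1
    linarith
  · have e : (k - 1) * ((T + (t - 1) * v) * (Q - t * u)) = (k - t) * (T * (Q - u))
        + (t - 1) * ((T + (k - 1) * v) * (Q - k * u)) + u * v * ((t - 1) * (k - t) * (k - 1)) := by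
      ring
    have h2 := mul_le_mul_of_nonneg_left hE₁ (sub_nonneg.mpr hk)
    have h3 := mul_le_mul_of_nonneg_left hE₂ (sub_nonneg.mpr h1)
    have h4 : 0 ≤ u * v * ((t - 1) * (k - t) * (k - 1)) :=
      mul_nonneg (mul_nonneg hu hv) (mul_nonneg (mul_nonneg (sub_nonneg.mpr h1)
        (sub_nonneg.mpr hk)) (sub_pos.mpr hk1).le)
    refine le_of_mul_le_mul_left ?_ (sub_pos.mpr hk1)
    rw [e]
    linarith

theorem add_epsilon_le {a b q α₁ α₂ N : ℕ} (ha : 0 < a) (h₁ : α₁ < a) (h₂ : α₂ < q)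
    (hT : (a - α₁) * (q - α₂)
      + (α₁ - (α₁ - α₁ % wt a b 1)) * (q - (α₂ + b)) ≤ N)
    (ht : ∃ t, 1 ≤ t ∧ t ≤ Nat.gcd a b ∧ (a - α₁) * (q - α₂)
      + (α₁ - (a - t * wt a b 1)) * (q - (α₂ + t * wt a b 0)) ≤ N) :
    ((a : ℚ) - α₁) * (q - α₂) + epsilon a b q α₁ α₂ ≤ N := by
  have hbase : (((a - α₁) * (q - α₂) : ℕ) : ℚ) = ((a : ℚ) - α₁) * (q - α₂) := by
    rw [Nat.cast_mul, Nat.cast_sub h₁.le, Nat.cast_sub h₂.le]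
  have hk0 : 0 < Nat.gcd a b := Nat.gcd_pos_of_pos_left b ha
  have hav : a = Nat.gcd a b * wt a b 1 := (Nat.mul_div_cancel' (Nat.gcd_dvd_left a b)).symm
  have hbu : b = Nat.gcd a b * wt a b 0 := (Nat.mul_div_cancel' (Nat.gcd_dvd_right a b)).symm
  unfold epsilon
  simp only
  generalize wt a b 0 = u at *
  generalize wt a b 1 = v at *
  generalize Nat.gcd a b = k at *
  split_ifs with c1 c2 c3
  · rw [add_zero, ← hbase]
    exact_mod_cast (Nat.le_add_right _ _).trans hT
  · have c1' : α₂ + b ≤ q := by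
      have : (α₂ : ℚ) + b ≤ q := by linarith [not_le.mp c1]
      exact_mod_cast this
    have : ((α₁ % v : ℕ) : ℚ) * (q - α₂ - b) = ((α₁ % v * (q - (α₂ + b)) : ℕ) : ℚ) := by
      push_cast [Nat.cast_sub c1']; ring
    rw [← hbase, this, ← Nat.cast_add, Nat.cast_le]
    rwa [Nat.sub_sub_self (Nat.mod_le _ _)] at hT
  -- Here `α₁ > a - v`, so `α₁ = l * v + T` with `l = gcd - 1` and `T` the remainder; the extra
  -- rectangle has area `(T + (t - 1) * v) * (q - α₂ - t * u)`.
  all_goals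
    have c1' : (α₂ : ℚ) + b < q := by linarith [not_le.mp c1]
    have c1'' : α₂ + b < q := by exact_mod_cast c1'
    have c2' : (a : ℚ) < α₁ + v := by linarith [not_le.mp c2]
    have c2'' : a < α₁ + v := by exact_mod_cast c2'
    obtain ⟨t, ht1, htk, ht⟩ := ht
    obtain ⟨l, rfl⟩ : ∃ l, k = l + 1 := ⟨k - 1, by omega⟩
    have hr : l * v ≤ α₁ := by rw [add_mul] at hav; omega
    obtain ⟨T, rfl⟩ := Nat.exists_eq_add_of_le hr
    have hTv : T < v := by rw [add_mul] at hav; omega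
    have hmod : (l * v + T) % v = T := by
      rw [Nat.mul_add_mod_self_right, Nat.mod_eq_of_lt hTv]
    have htu : t * u ≤ b := hbu ▸ Nat.mul_le_mul_right u htk
    have htv : t * v ≤ a := hav ▸ Nat.mul_le_mul_right v htk
    have hx : a - t * v ≤ l * v + T := by
      have : v ≤ t * v := Nat.le_mul_of_pos_left v ht1
      omega
    have hg : (((l * v + T - (a - t * v)) * (q - (α₂ + t * u)) : ℕ) : ℚ)
        = (T + ((t : ℚ) - 1) * v) * ((q - α₂) - t * u) := by
      rw [Nat.cast_mul, Nat.cast_sub hx, Nat.cast_sub htv,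
        Nat.cast_sub (show α₂ + t * u ≤ q by omega)]
      push_cast [hav]
      ring
    have ht' : (((a - (l * v + T)) * (q - α₂) : ℕ) : ℚ)
        + (((l * v + T - (a - t * v)) * (q - (α₂ + t * u)) : ℕ) : ℚ) ≤ N := by
      exact_mod_cast ht
    rw [hg] at ht'
    rw [← hbase]
    refine le_trans (add_le_add_right ?_ _) ht'
    have ht1q : (1 : ℚ) ≤ t := by exact_mod_cast ht1
    have htkq : (t : ℚ) ≤ l + 1 := by exact_mod_cast htk
    have hvpos : (0 : ℚ) < v := by exact_mod_cast (Nat.zero_le T).trans_lt hTv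
    have havq : (a : ℚ) = (l + 1) * v := by exact_mod_cast hav
    have hbuq : (b : ℚ) = (l + 1) * u := by exact_mod_cast hbu
    -- The sign of the difference of the endpoint values is what the threshold on `α₂` in `epsilon`
    -- decides.
    have hdiff : (T : ℚ) * (q - α₂ - u) - (T + ((l + 1 : ℚ) - 1) * v) * (q - α₂ - (l + 1) * u)
      = l * ((l * v + T) * u - v * (q - α₂ - u)) := by ring
    have hl0 : (0 : ℚ) ≤ l := Nat.cast_nonneg l
    -- The factor `l` absorbs the case `gcd = 1`, where the quotient is `0 / 0`.
    have hquot : (l : ℚ) * (((b : ℚ) - u) / (a - v)) = l * (u / v) := by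
      rcases hl0.eq_or_lt with h | h
      · rw [← h, zero_mul, zero_mul]
      · rw [show (b : ℚ) - u = l * u by rw [hbuq]; ring, show (a : ℚ) - v = l * v by rw [havq]; ring,
          mul_div_mul_left _ _ h.ne']
    have hcond : (l : ℚ) * (v * (q - u - ((l * v + T : ℕ) : ℚ) * ((b - u) / (a - v))))
        = l * (v * (q - u)) - l * ((l * v + T) * u) := by
      rw [show (l : ℚ) * (v * (q - u - ((l * v + T : ℕ) : ℚ) * ((b - u) / (a - v))))
        = l * (v * (q - u)) - v * ((l * v + T : ℕ) : ℚ) * (l * ((b - u) / (a - v))) by ring, hquot]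
      push_cast
      field_simp
    refine le_of_two_bounds (k := l + 1) (Nat.cast_nonneg u) hvpos.le ht1q htkq ?_ ?_
  · have := mul_le_mul_of_nonneg_left (mul_le_mul_of_nonneg_left c3.le hvpos.le) hl0
    rw [hcond] at this
    rw [hbuq]
    push_cast
    nlinarith
  · rw [hbuq]
    push_cast
    exact le_of_eq (by ring)
  · rw [hmod]
  · rw [hmod]
    have := mul_le_mul_of_nonneg_left (mul_le_mul_of_nonneg_left (not_lt.mp c3) hvpos.le) hl0
    rw [hcond] at this
    nlinarith

end GenCab

namespace GenCab

/-! ### The codes of generalised `C_ab` polynomials -/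

theorem degree_eq_of_forall_le {σ R : Type*} [CommSemiring R] {m : MonomialOrder σ}
    {f : MvPolynomial σ R} {d : σ →₀ ℕ} (hd : f.coeff d ≠ 0)
    (h : ∀ e ∈ f.support, e ≼[m] d) : m.degree f = d :=
  m.toSyn.injective (le_antisymm (m.degree_le_iff.mpr h)
    (m.le_degree (MvPolynomial.mem_support_iff.mpr hd)))

/-- Leading monomials of an ideal are closed under multiples: multiply `f` by the missing monomial.
-/
theorem not_degree_le_of_mem_footprint {σ k : Type*} [Field k] {m : MonomialOrder σ}
    {J : Ideal (MvPolynomial σ k)} {d : σ →₀ ℕ} (hd : d ∈ footprint m J) {f : MvPolynomial σ k}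
    (hf : f ∈ J) (hf0 : f ≠ 0) : ¬ m.degree f ≤ d := fun hle => by
  have h1 : MvPolynomial.monomial (d - m.degree f) (1 : k) ≠ 0 := by simp
  refine hd _ (J.mul_mem_left (MvPolynomial.monomial (d - m.degree f) (1 : k)) hf)
    (mul_ne_zero h1 hf0) ?_
  classical
  rw [MonomialOrder.degree_mul h1 hf0, MonomialOrder.degree_monomial, if_neg one_ne_zero,
    tsub_add_cancel_of_le hle]

theorem weight_eq_wdeg (w : Fin 2 → ℕ) (d : Fin 2 →₀ ℕ) :
    Finsupp.weight w d = wdeg (w 0) (w 1) (d 0, d 1) := by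
  rw [Finsupp.weight_apply, Finsupp.sum_fintype _ _ (by simp)]
  simp [wdeg]

/-- Among monomials of equal weight, equal `X`-exponents force equal `Y`-exponents, so the
lexicographic tie-break is decided by `X` alone. -/
theorem lkey_lt_of_wDegLex_lt {w : Fin 2 → ℕ} (hw : 0 < w 1) {d e : Fin 2 →₀ ℕ}
    (h : d ≺[wDegLex w] e) :
    lkey (w 0) (w 1) (d 0, d 1) < lkey (w 0) (w 1) (e 0, e 1) := by
  rw [wDegLex_lt_iff, weight_eq_wdeg, weight_eq_wdeg] at h
  rw [lkey_lt_iff]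
  refine h.imp_right fun ⟨h1, h2⟩ => ⟨h1, ?_⟩
  obtain ⟨j, hj, hlt⟩ := Finsupp.Lex.lt_iff.mp h2
  fin_cases j
  · exact hlt
  · have h0 : d 0 = e 0 := hj 0 (by simp)
    have h1' : d 1 < e 1 := hlt
    simp only [wdeg, h0, Nat.add_left_cancel_iff] at h1
    exact absurd (Nat.eq_of_mul_eq_mul_right hw h1) h1'.ne

variable {K : Type*} [Field K]

theorem IsGenCab.degree_eq {a b : ℕ} {F : MvPolynomial (Fin 2) K} (hF : IsGenCab a b F) :
    F ≠ 0 ∧ (wDegLex (wt a b)).degree F = Finsupp.single 0 a := by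
  classical
  obtain ⟨ha, hb, -, α, R, hα, rfl, hR⟩ := hF
  have hwa : Finsupp.weight (wt a b) (Finsupp.single 0 a) = a * b / Nat.gcd a b := by
    rw [Finsupp.weight_single, smul_eq_mul, Nat.mul_div_assoc _ (Nat.gcd_dvd_right a b)]
    rfl
  have hwb : Finsupp.weight (wt a b) (Finsupp.single 1 b) = a * b / Nat.gcd a b := by
    rw [Finsupp.weight_single, smul_eq_mul, mul_comm a b,
      Nat.mul_div_assoc _ (Nat.gcd_dvd_left a b)]
    rfl
  have hRa : R.coeff (Finsupp.single 0 a) = 0 := by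
    by_contra h
    exact (hR _ (MvPolynomial.mem_support_iff.mpr h)).ne hwa
  have hne : (Finsupp.single 1 b : Fin 2 →₀ ℕ) ≠ Finsupp.single 0 a := fun h => by
    have := DFunLike.congr_fun h 0
    simp at this
    omega
  have hcoeff : (MvPolynomial.X 0 ^ a + MvPolynomial.C α * MvPolynomial.X 1 ^ b + R).coeff
      (Finsupp.single 0 a) ≠ 0 := by
    simp [MvPolynomial.coeff_X_pow, MvPolynomial.coeff_C_mul, hRa, hne]
  refine ⟨fun h => hcoeff (by rw [h, MvPolynomial.coeff_zero]), degree_eq_of_forall_le hcoeff ?_⟩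
  intro e he
  by_cases h1 : Finsupp.single 0 a = e
  · rw [h1]
  refine le_of_lt ((wDegLex_lt_iff _ _ _).mpr ?_)
  by_cases h2 : Finsupp.single 1 b = e
  · subst h2
    refine Or.inr ⟨hwb.trans hwa.symm, Finsupp.Lex.lt_iff.mpr ⟨0, by simp, ?_⟩⟩
    simpa using ha
  · left
    rw [hwa]
    refine hR e ?_
    rw [MvPolynomial.mem_support_iff] at he ⊢
    simpa [MvPolynomial.coeff_X_pow, MvPolynomial.coeff_C_mul, h1, h2] using he

theorem degree_X_pow_sub_X {w : Fin 2 → ℕ} {q : ℕ} (hq : 1 < q) (hw : 0 < w 1) :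
    (MvPolynomial.X 1 ^ q - MvPolynomial.X 1 : MvPolynomial (Fin 2) K) ≠ 0 ∧
      (wDegLex w).degree (MvPolynomial.X 1 ^ q - MvPolynomial.X 1 : MvPolynomial (Fin 2) K)
        = Finsupp.single 1 q := by
  classical
  have hne : (Finsupp.single 1 1 : Fin 2 →₀ ℕ) ≠ Finsupp.single 1 q := fun h => by
    have := DFunLike.congr_fun h 1
    simp at this
    omega
  have hcoeff : (MvPolynomial.X 1 ^ q - MvPolynomial.X 1 : MvPolynomial (Fin 2) K).coeff
      (Finsupp.single 1 q) ≠ 0 := by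
    simp [MvPolynomial.coeff_X_pow, MvPolynomial.coeff_X, hne]
  refine ⟨fun h => hcoeff (by rw [h, MvPolynomial.coeff_zero]), degree_eq_of_forall_le hcoeff ?_⟩
  intro e he
  by_cases h1 : Finsupp.single 1 q = e
  · rw [h1]
  refine le_of_lt ((wDegLex_lt_iff _ _ _).mpr (Or.inl ?_))
  by_cases h2 : Finsupp.single 1 1 = e
  · subst h2
    rw [Finsupp.weight_single, Finsupp.weight_single]
    exact Nat.mul_lt_mul_of_pos_right hq hw
  · rw [MvPolynomial.mem_support_iff] at he
    exact absurd (by simp [MvPolynomial.coeff_X_pow, MvPolynomial.coeff_X, h1, h2]) he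

theorem wt_one_pos {a b : ℕ} (ha : 0 < a) : 0 < wt a b 1 :=
  Nat.div_pos (Nat.le_of_dvd ha (Nat.gcd_dvd_left a b)) (Nat.gcd_pos_of_pos_left b ha)

theorem zeroLocus_idealQ [Fintype K] (F : MvPolynomial (Fin 2) K) :
    MvPolynomial.zeroLocus K (idealQ (Ideal.span {F})) = {P | MvPolynomial.eval P F = 0} := by
  rw [idealQ, ← Ideal.span_union, MvPolynomial.zeroLocus_span]
  ext P
  simp only [Set.singleton_union, Set.forall_mem_insert, Set.forall_mem_range, Set.mem_ofPred_eq,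
    MvPolynomial.aeval_eq_eval]
  simp [FiniteField.pow_card]

/-- `F` and `Y ^ q - Y` have leading monomials `X ^ a` and `Y ^ q`. Only this inclusion is needed,
not equality with the box. -/
theorem mem_box_of_mem_footprint [Fintype K] {a b : ℕ} {F : MvPolynomial (Fin 2) K}
    (hF : IsGenCab a b F) {d : Fin 2 →₀ ℕ}
    (hd : d ∈ footprint (wDegLex (wt a b)) (idealQ (Ideal.span {F}))) :
    (d 0, d 1) ∈ box a (Fintype.card K) := by
  constructor
  · have h := not_degree_le_of_mem_footprint hd
      (Ideal.mem_sup_left (Ideal.mem_span_singleton_self F)) hF.degree_eq.1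
    rw [hF.degree_eq.2, Finsupp.single_le_iff] at h
    simpa using h
  · have hdeg := degree_X_pow_sub_X (K := K) (Fintype.one_lt_card (α := K))
      (wt_one_pos (b := b) hF.1)
    have h := not_degree_le_of_mem_footprint hd
      (Ideal.mem_sup_right (Ideal.subset_span ⟨1, rfl⟩)) hdeg.1
    rw [hdeg.2, Finsupp.single_le_iff] at h
    simpa using h

/-- The coordinate functions on the points of the variety of `J`. -/
def coord {σ : Type*} (J : Ideal (MvPolynomial σ K)) (j : σ) : Points J → K := fun P => P.1 j

theorem eval_eq_sum_mon (J : Ideal (MvPolynomial (Fin 2) K)) (f : MvPolynomial (Fin 2) K) :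
    (fun P : Points J => MvPolynomial.eval P.1 f)
      = ∑ d ∈ f.support, f.coeff d • mon (coord J 0) (coord J 1) (d 0, d 1) := by
  ext P
  simp [MvPolynomial.eval_eq', mon, coord]

/-- Extend a function on the points by zero to the whole finite affine space, where every function
is polynomial. -/
theorem top_le_span_mon [Fintype K] (J : Ideal (MvPolynomial (Fin 2) K)) :
    ⊤ ≤ Submodule.span K (Set.range (mon (coord J 0) (coord J 1))) := by
  classical
  rintro g -
  have h := MvPolynomial.map_restrict_dom_evalₗ K (Fin 2)
  have hmem : (fun P : Fin 2 → K => if hP : P ∈ MvPolynomial.zeroLocus K J then g ⟨P, hP⟩ else 0)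
      ∈ (MvPolynomial.restrictDegree (Fin 2) K (Fintype.card K - 1)).map
        (MvPolynomial.evalₗ K (Fin 2)) := h ▸ Submodule.mem_top
  obtain ⟨f, -, hf⟩ := hmem
  have hg : g = fun P : Points J => MvPolynomial.eval P.1 f := by
    ext P
    have := congrFun hf P.1
    rw [MvPolynomial.evalₗ_apply, dif_pos P.2] at this
    exact this.symm
  rw [hg, eval_eq_sum_mon]
  exact sum_mem fun d _ => Submodule.smul_mem _ _ (Submodule.subset_span ⟨_, rfl⟩)

theorem IsGenCab.exists_curveRel [Fintype K] {a b : ℕ} {F : MvPolynomial (Fin 2) K}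
    (hF : IsGenCab a b F) : ∃ α : K, CurveRel a b (Fintype.card K) (wt a b 0) (wt a b 1) α
      (coord (idealQ (Ideal.span {F})) 0) (coord (idealQ (Ideal.span {F})) 1) := by
  obtain ⟨ha, hb, -, α, R, hα, rfl, hR⟩ := hF
  have hwa : a * wt a b 0 = a * b / Nat.gcd a b :=
    (Nat.mul_div_assoc _ (Nat.gcd_dvd_right a b)).symm
  have hwb : b * wt a b 1 = a * b / Nat.gcd a b := by
    rw [mul_comm a b]
    exact (Nat.mul_div_assoc _ (Nat.gcd_dvd_left a b)).symm
  refine ⟨α, wt_one_pos ha, Fintype.one_lt_card,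
    (Nat.coprime_div_gcd_div_gcd (Nat.gcd_pos_of_pos_left b ha)).symm, hwa.trans hwb.symm, ha, hα,
    ?_, ?_⟩
  · ext P
    exact FiniteField.pow_card _
  · set J := idealQ (Ideal.span
      {MvPolynomial.X 0 ^ a + MvPolynomial.C α * MvPolynomial.X 1 ^ b + R})
    have h1 : coord J 0 ^ a + α • coord J 1 ^ b
        = -(fun P : Points J => MvPolynomial.eval P.1 R) := by
      ext P
      have hP' : MvPolynomial.eval P.1
          (MvPolynomial.X 0 ^ a + MvPolynomial.C α * MvPolynomial.X 1 ^ b + R) = 0 :=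
        (Set.ext_iff.mp (zeroLocus_idealQ _) P.1).mp P.2
      simp only [map_add, map_mul, map_pow, MvPolynomial.eval_X, MvPolynomial.eval_C] at hP'
      simpa [coord] using eq_neg_of_add_eq_zero_left hP'
    rw [h1, eval_eq_sum_mon]
    refine neg_mem (sum_mem fun d hd => Submodule.smul_mem _ _ (Submodule.subset_span ⟨_, ?_, rfl⟩))
    have := hR d hd
    rw [weight_eq_wdeg] at this
    rw [Set.mem_ofPred_eq, hwa]
    exact this

theorem IsOptimalGenCab.card_points [Fintype K] {a b : ℕ} {F : MvPolynomial (Fin 2) K}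
    (hF : IsOptimalGenCab a b F) :
    Fintype.card (Points (idealQ (Ideal.span {F}))) = a * Fintype.card K := by
  rw [← hF.2, ← zeroLocus_idealQ, ← Nat.card_eq_fintype_card]
  rfl

end GenCab

/-! ### Assembling the bound -/

theorem mainTheorem2 {K : Type*} [Field K] [Fintype K] [DecidableEq K]
    (a b : ℕ) (F : MvPolynomial (Fin 2) K) (hF : GenCab.IsOptimalGenCab a b F)
    -- `M` lists the footprint of `I_q` in increasing order
    (n : ℕ) (M : Fin n → (Fin 2 →₀ ℕ))
    (hM : ∀ s t : Fin n, s < t → M s ≺[GenCab.wDegLex (GenCab.wt a b)] M t)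
    (hrange : Set.range M = GenCab.footprint (GenCab.wDegLex (GenCab.wt a b))
      (GenCab.idealQ (Ideal.span {F})))
    (i : Fin n) (coef : Fin n → K) (hi : coef i ≠ 0)
    (c : GenCab.Points (GenCab.idealQ (Ideal.span {F})) → K)
    (hc : c = GenCab.ev (GenCab.idealQ (Ideal.span {F}))
      (Ideal.Quotient.mk _ (∑ s ∈ Finset.Iic i, MvPolynomial.monomial (M s) (coef s)))) :
    ((a : ℚ) - M i 0) * ((Fintype.card K : ℚ) - M i 1)
      + GenCab.epsilon a b (Fintype.card K) (M i 0) (M i 1) ≤ (hammingNorm c : ℚ) := by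
  classical
  obtain ⟨α, H⟩ := hF.1.exists_curveRel
  have ha : 0 < a := hF.1.1
  have hbox := GenCab.mem_box_of_mem_footprint hF.1 (hrange ▸ Set.mem_range_self i)
  have hlt : ∀ s t : Fin n, s < t → GenCab.lkey (GenCab.wt a b 0) (GenCab.wt a b 1) (M s 0, M s 1)
      < GenCab.lkey (GenCab.wt a b 0) (GenCab.wt a b 1) (M t 0, M t 1) :=
    fun s t h => GenCab.lkey_lt_of_wDegLex_lt H.v_pos (hM s t h)
  have hinj : Function.Injective fun s : Fin n => (M s 0, M s 1) := fun s t h => by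
    rcases lt_trichotomy s t with h' | h' | h'
    · exact absurd (congrArg _ h) (hlt s t h').ne
    · exact h'
    · exact absurd (congrArg _ h).symm (hlt t s h').ne
  have hext : ∀ s, Function.extend (fun s : Fin n => (M s 0, M s 1)) coef 0 (M s 0, M s 1) = coef s :=
    fun s => hinj.extend_apply coef 0 s
  -- Zero coefficients are discarded, since any term of `S` may have to serve as a leading term.
  obtain ⟨S, hSdef⟩ : ∃ S : Finset (ℕ × ℕ), S = ((Finset.Iic i).filter fun s => coef s ≠ 0).image
    fun s : Fin n => (M s 0, M s 1) := ⟨_, rfl⟩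
  have hcS : c = ∑ p ∈ S, Function.extend (fun s : Fin n => (M s 0, M s 1)) coef 0 p •
      GenCab.mon (GenCab.coord (GenCab.idealQ (Ideal.span {F})) 0)
        (GenCab.coord (GenCab.idealQ (Ideal.span {F})) 1) p := by
    rw [hSdef, Finset.sum_image hinj.injOn, Finset.sum_filter_of_ne, hc]
    · ext P
      simp [GenCab.ev, hext, GenCab.mon, GenCab.coord, MvPolynomial.eval_monomial,
        Finsupp.prod_fintype]
    · intro s _ h hs
      exact h (by rw [hext, hs, zero_smul])
  have hA : (M i 0, M i 1) ∈ S := hSdef ▸ Finset.mem_image.mpr ⟨i, by simp [hi], rfl⟩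
  have hC : ∀ p ∈ S, Function.extend (fun s : Fin n => (M s 0, M s 1)) coef 0 p ≠ 0 := by
    rw [hSdef, Finset.forall_mem_image]
    intro s hs
    rw [hext]
    exact (Finset.mem_filter.mp hs).2
  have hS : ∀ p ∈ S, p ≠ (M i 0, M i 1) → GenCab.lkey (GenCab.wt a b 0) (GenCab.wt a b 1) p
      < GenCab.lkey (GenCab.wt a b 0) (GenCab.wt a b 1) (M i 0, M i 1) := by
    rw [hSdef, Finset.forall_mem_image]
    intro s hs hne
    refine hlt s i (lt_of_le_of_ne (Finset.mem_Iic.mp (Finset.mem_filter.mp hs).1) ?_)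
    rintro rfl
    exact hne rfl
  have he := H.linearIndepOn_box hF.card_points (GenCab.top_le_span_mon _)
  rw [hcS]
  refine GenCab.add_epsilon_le ha hbox.1 hbox.2 ?_ ?_
  · exact GenCab.rectangles_le_hammingNorm H.v_pos he hbox.1.le
      (fun _ _ h1 _ h2 _ => H.isLead_mul hA hC hS h1 h2)
      (fun _ _ h1 h2 h3 _ => H.isLead_mod hA hC hS hbox.1 h1 h2 h3)
  · obtain ⟨t, ht1, htk, ht⟩ := H.exists_isLead hA hC hS hbox.1
      (Nat.mul_div_cancel' (Nat.gcd_dvd_left a b)).symm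
      (Nat.mul_div_cancel' (Nat.gcd_dvd_right a b)).symm
    exact ⟨t, ht1, htk, GenCab.rectangles_le_hammingNorm H.v_pos he hbox.1.le
      (fun _ _ h1 _ h2 _ => H.isLead_mul hA hC hS h1 h2)
      (fun _ _ h1 h2 h3 _ => ht _ _ h1 h2 h3)⟩
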